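/- Let $\alpha,\beta,r\in\mathbb{C}$ and let $n\ge 0$ be an integer. For $z\in\mathbb{C}$ put $(z\mid\alpha)_0=1$ and $(z\mid\alpha)_n=z(z-\alpha)\cdots(z-(n-1)\alpha)$ for $n\ge 1$. Let the generalized Stirling numbers $S(m,k;\alpha,\beta,r)$ be defined by the formal power series identity $$\left(\frac{(1+\alpha t)^{\beta/\alpha}-1}{\beta}\right)^{k}(1+\alpha t)^{r/\alpha}=k!\sum_{m=0}^{\infty}S(m,k;\alpha,\beta,r)\frac{t^{m}}{m!}\qquad(k\ge 0),$$ where $(1+\alpha t)^{c/\alpha}=\sum_{m\ge 0}(c\mid\alpha)_m\,t^m/m!$ and $\frac{(1+\alpha t)^{\beta/\alpha}-1}{\beta}=\sum_{m\ge 1}(\beta-\alpha\mid\alpha)_{m-1}\,t^m/m!$; for $\alpha=0$ or $\beta=0$ these last two formulas give the limiting values (for example $e^{ct}$ for the first one when $\alpha=0$, and $\alpha^{-1}\log(1+\alpha t)$ for the second one when $\beta=0\ne\alpha$). Then, for every complex $x$ with $|x|<1$, the following series converges (absolutely) and $$\sum_{k=1}^{\infty}\zeta(k+1)\,(r+k\beta\mid\alpha)_n\,x^{k}=-(r\mid\alpha)_n\bigl(\psi(1-x)+\gamma\bigr)+\sum_{k=1}^{n}S(n,k;\alpha,\beta,r)\,k!\,\zeta(k+1,1-x)\,(\beta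 x)^{k},$$ where $\zeta(s)$ is the Riemann zeta function, $\psi=\Gamma'/\Gamma$ is the digamma function, $\gamma$ is Euler's constant, and $\zeta(s,a)=\sum_{m=0}^{\infty}(m+a)^{-s}$ for $\operatorname{Re}s>1$, $\operatorname{Re}a>0$, is the Hurwitz zeta function. -/

import Mathlib

noncomputable section

/-- The generalized factorial `(z | α)_n = z (z - α) ⋯ (z - (n - 1) α)`, with `(z | α)_0 = 1`. -/
def genFactorial (z α : ℂ) (n : ℕ) : ℂ :=
  ∏ i ∈ Finset.range n, (z - i * α)

/-- The formal power series `(1 + α t)^(c / α) = ∑ (c | α)_n t^n / n!`; for `α = 0` it is the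
limiting series `exp (c t)`. -/
def genBinomialSeries (α c : ℂ) : PowerSeries ℂ :=
  PowerSeries.mk fun n => genFactorial c α n / (n.factorial : ℂ)

theorem genBinomialSeries_of_ne_zero {α : ℂ} (hα : α ≠ 0) (c : ℂ) :
    genBinomialSeries α c =
      PowerSeries.rescale α (PowerSeries.binomialSeries ℂ (c / α)) := by
  ext n
  have hn : (n.factorial : ℂ) ≠ 0 := by exact_mod_cast n.factorial_ne_zero
  have h := Ring.descPochhammer_eq_factorial_smul_choose (c / α) n
  have hp : (descPochhammer ℤ n).smeval (c / α) = ∏ i ∈ Finset.range n, (c / α - i) := by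
    clear h hn
    induction n with
    | zero => simp
    | succ n ih =>
      rw [descPochhammer_succ_right, Polynomial.smeval_mul, ih, Finset.prod_range_succ]
      simp [Polynomial.smeval_natCast]
  rw [hp, nsmul_eq_mul] at h
  rw [PowerSeries.coeff_rescale, PowerSeries.binomialSeries_coeff, genBinomialSeries,
    PowerSeries.coeff_mk, smul_eq_mul, mul_one, div_eq_iff hn, mul_assoc, mul_comm (Ring.choose _ _),
    ← h, genFactorial]
  rw [← Finset.card_range n, ← Finset.prod_const, Finset.card_range, ← Finset.prod_mul_distrib]
  refine Finset.prod_congr rfl fun i _ => ?_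
  field_simp

theorem genBinomialSeries_zero (c : ℂ) :
    genBinomialSeries 0 c = PowerSeries.rescale c (PowerSeries.exp ℂ) := by
  ext n
  simp [genBinomialSeries, genFactorial, PowerSeries.coeff_exp, div_eq_mul_inv]

/-- The formal power series `((1 + α t)^(β / α) - 1) / β`, that is,
`∑_{n ≥ 1} (β - α | α)_(n-1) t^n / n!`. For `α = 0` or `β = 0` it is the limiting series
`(exp (β t) - 1) / β`, `log (1 + α t) / α`, or `t`. -/
def genDiffSeries (α β : ℂ) : PowerSeries ℂ :=
  PowerSeries.mk fun n =>
    if n = 0 then 0 else genFactorial (β - α) α (n - 1) / (n.factorial : ℂ)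

theorem C_mul_genDiffSeries (α β : ℂ) :
    PowerSeries.C β * genDiffSeries α β = genBinomialSeries α β - 1 := by
  ext n
  rcases n with _ | n
  · simp [genDiffSeries, genBinomialSeries, genFactorial]
  · simp only [genDiffSeries, genBinomialSeries, PowerSeries.coeff_C_mul, PowerSeries.coeff_mk,
      map_sub, PowerSeries.coeff_one, genFactorial, Finset.prod_range_succ']
    simp only [Nat.add_eq_zero_iff, one_ne_zero, and_false, if_false, Nat.add_sub_cancel]
    have : ∀ i : ℕ, β - α - i * α = β - ((i + 1 : ℕ) : ℂ) * α := fun i => by push_cast; ring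
    simp only [this]
    push_cast
    ring

theorem C_mul_genDiffSeries_zero (α : ℂ) :
    PowerSeries.C α * genDiffSeries α 0 = PowerSeries.rescale α (PowerSeries.log ℂ) := by
  ext n
  rcases n with _ | n
  · simp [genDiffSeries]
  · have h : genFactorial (0 - α) α n = (-α) ^ n * (n.factorial : ℂ) := by
      rw [genFactorial, ← Finset.prod_range_add_one_eq_factorial, Nat.cast_prod]
      conv_rhs => rw [← Finset.card_range n, ← Finset.prod_const, Finset.card_range,
        ← Finset.prod_mul_distrib]
      refine Finset.prod_congr rfl fun i _ => ?_
      push_cast; ring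
    have hn : (n.factorial : ℂ) ≠ 0 := by exact_mod_cast n.factorial_ne_zero
    have hn' : (n : ℂ) + 1 ≠ 0 := by exact_mod_cast n.succ_ne_zero
    simp only [genDiffSeries, PowerSeries.coeff_C_mul, PowerSeries.coeff_mk,
      PowerSeries.coeff_rescale, PowerSeries.coeff_log, Nat.add_eq_zero_iff, one_ne_zero,
      and_false, if_false, Nat.add_sub_cancel, h, Nat.factorial_succ]
    simp
    field_simp
    ring_nf

theorem genDiffSeries_zero_zero : genDiffSeries 0 0 = PowerSeries.X := by
  ext n
  rcases n with _ | _ | n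
  · simp [genDiffSeries]
  · simp [genDiffSeries, genFactorial]
  · simp [genDiffSeries, genFactorial, PowerSeries.coeff_X]

/-- The generalized Stirling numbers `S(n, k; α, β, r)`, given by the generating function
`(((1 + α t)^(β / α) - 1) / β)^k (1 + α t)^(r / α) = k! ∑_n S(n, k; α, β, r) t^n / n!`. -/
def genStirling (n k : ℕ) (α β r : ℂ) : ℂ :=
  (n.factorial : ℂ) / (k.factorial : ℂ) *
    PowerSeries.coeff n (genDiffSeries α β ^ k * genBinomialSeries α r)

/-- The Hurwitz zeta function `ζ(s, a) = ∑_{m ≥ 0} (m + a)^(-s)` of a complex parameter `a`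
with `0 < Re a`, on the half plane `1 < Re s`. -/
def hurwitzZetaSeries (s a : ℂ) : ℂ :=
  ∑' m : ℕ, 1 / ((m : ℂ) + a) ^ s

theorem summable_hurwitzZetaSeries {k : ℕ} (hk : 2 ≤ k) {a : ℂ} (ha : 0 < a.re) :
    Summable fun m : ℕ => 1 / ((m : ℂ) + a) ^ (k : ℂ) := by
  have h := (Real.summable_one_div_nat_add_rpow a.re k).2 (by exact_mod_cast hk)
  refine Summable.of_norm_bounded h fun m => ?_
  have hm : 0 < (m : ℝ) + a.re := by positivity
  have hle : (m : ℝ) + a.re ≤ ‖(m : ℂ) + a‖ := by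
    simpa using Complex.re_le_norm ((m : ℂ) + a)
  rw [Complex.cpow_natCast, norm_div, norm_pow, norm_one, abs_of_pos hm, Real.rpow_natCast]
  gcongr

end

open Filter Topology

/-! Exponents add, so with `D = genDiffSeries α β` the series of `r + k * β` is that of `r` times
`(1 + β D) ^ k`. The binomial theorem turns this into `genFactorial_add_nat_mul`, a finite
combination of the `k.choose j`, `j ≤ n`. It remains to sum `ζ(k + 1) (k choose j) x ^ k` over `k ≥
1`. Expanding zeta and exchanging the sums leaves, for each `m`, a binomial-geometric series in `y =
x / (m + 1)`. For `j ≥ 1` these add up to a Hurwitz zeta value. For `j = 0` they give `∑ (1 / (m + 1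
- x) - 1 / (m + 1))`, which `tsum_digamma` evaluates by logarithmic differentiation of the
Weierstrass product of `exp (γ x) / Γ(1 - x)`. -/

theorem genBinomialSeries_add (α c d : ℂ) :
    genBinomialSeries α (c + d) = genBinomialSeries α c * genBinomialSeries α d := by
  rcases eq_or_ne α 0 with rfl | hα
  · simp only [genBinomialSeries_zero, PowerSeries.exp_mul_exp_eq_exp_add]
  · rw [genBinomialSeries_of_ne_zero hα, genBinomialSeries_of_ne_zero hα,
      genBinomialSeries_of_ne_zero hα, add_div, PowerSeries.binomialSeries_add, map_mul]

theorem genBinomialSeries_nat_mul (α c : ℂ) (k : ℕ) :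
    genBinomialSeries α (k * c) = genBinomialSeries α c ^ k := by
  induction k with
  | zero =>
    ext n
    cases n <;> simp [genBinomialSeries, genFactorial, Finset.prod_range_succ']
  | succ k ih =>
    rw [Nat.cast_succ, add_mul, one_mul, genBinomialSeries_add, ih, pow_succ]

theorem X_dvd_genDiffSeries (α β : ℂ) : (PowerSeries.X : PowerSeries ℂ) ∣ genDiffSeries α β := by
  rw [PowerSeries.X_dvd_iff, ← PowerSeries.coeff_zero_eq_constantCoeff_apply]
  simp [genDiffSeries]

theorem genStirling_eq_zero_of_lt {n k : ℕ} (h : n < k) (α β r : ℂ) :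
    genStirling n k α β r = 0 := by
  rw [genStirling, PowerSeries.X_pow_dvd_iff.1
    ((pow_dvd_pow_of_dvd (X_dvd_genDiffSeries α β) k).mul_right _) n h, mul_zero]

theorem genStirling_zero_right (n : ℕ) (α β r : ℂ) :
    genStirling n 0 α β r = genFactorial r α n := by
  have hn : (n.factorial : ℂ) ≠ 0 := by exact_mod_cast n.factorial_ne_zero
  simp [genStirling, genBinomialSeries]
  field_simp

/-- Expansion of the generalized factorial in binomial coefficients. -/
theorem genFactorial_add_nat_mul (n k : ℕ) (α β r : ℂ) :
    genFactorial (r + k * β) α n =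
      ∑ j ∈ Finset.range (n + 1),
        genStirling n j α β r * (j.factorial : ℂ) * β ^ j * (k.choose j : ℂ) := by
  have hn : (n.factorial : ℂ) ≠ 0 := by exact_mod_cast n.factorial_ne_zero
  have hterm (j : ℕ) : PowerSeries.coeff n
      ((PowerSeries.C β * genDiffSeries α β) ^ j * (k.choose j : PowerSeries ℂ) *
        genBinomialSeries α r) * n.factorial =
      genStirling n j α β r * (j.factorial : ℂ) * β ^ j * (k.choose j : ℂ) := by
    have hj : (j.factorial : ℂ) ≠ 0 := by exact_mod_cast j.factorial_ne_zero
    have : (PowerSeries.C β * genDiffSeries α β) ^ j * (k.choose j : PowerSeries ℂ) *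
        genBinomialSeries α r = PowerSeries.C (β ^ j * (k.choose j : ℂ)) *
          (genDiffSeries α β ^ j * genBinomialSeries α r) := by
      simp only [map_mul, map_pow, map_natCast]
      ring
    rw [this, PowerSeries.coeff_C_mul, genStirling]
    field_simp
  have h : genFactorial (r + k * β) α n = PowerSeries.coeff n
      ((PowerSeries.C β * genDiffSeries α β + 1) ^ k * genBinomialSeries α r) * n.factorial := by
    rw [C_mul_genDiffSeries, sub_add_cancel, ← genBinomialSeries_nat_mul, ← genBinomialSeries_add,
      genBinomialSeries, PowerSeries.coeff_mk, div_mul_cancel₀ _ hn, add_comm]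
  rw [h, add_pow, Finset.sum_mul, map_sum, Finset.sum_mul]
  simp only [one_pow, mul_one, hterm]
  -- The two ranges may be exchanged: `k.choose j` vanishes for `j > k`, and `genStirling n j` for
  -- `j > n`.
  rcases le_total k n with hkn | hkn
  · refine Finset.sum_subset (by gcongr) fun j _ hj => ?_
    rw [Nat.choose_eq_zero_of_lt (by simpa using hj), Nat.cast_zero, mul_zero]
  · refine (Finset.sum_subset (by gcongr) fun j _ hj => ?_).symm
    rw [genStirling_eq_zero_of_lt (by simpa using hj)]
    simp

/-! ### Binomial sums of zeta values -/

theorem hasSum_choose_mul_pow {y : ℂ} (hy : ‖y‖ < 1) (j : ℕ) :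
    HasSum (fun k : ℕ => (k.choose j : ℂ) * y ^ k) (y ^ j / (1 - y) ^ (j + 1)) := by
  rw [← hasSum_nat_add_iff' j, Finset.sum_eq_zero, sub_zero]
  · convert! (hasSum_choose_mul_geometric_of_norm_lt_one j hy).mul_left (y ^ j) using 1
    · ext k; ring
    · ring
  · intro k hk
    rw [Nat.choose_eq_zero_of_lt (by simpa using hk), Nat.cast_zero, zero_mul]

theorem hasSum_riemannZeta_nat_add_two (k : ℕ) :
    HasSum (fun m : ℕ => 1 / ((m : ℂ) + 1) ^ (k + 2)) (riemannZeta (((k + 1 : ℕ) : ℂ) + 1)) := by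
  have h := (summable_hurwitzZetaSeries (k := k + 2) (by lia) (a := 1) (by simp)).hasSum
  rw [← zeta_eq_tsum_one_div_nat_add_one_cpow (by norm_cast; lia)] at h
  simp only [Complex.cpow_natCast] at h
  convert! h using 2
  push_cast; ring

/-- Since `m + 1 ≥ 1`, the power `k + 2` may be lowered to `2`, and the bound is a product of two
summable series in separate variables. -/
theorem summable_choose_mul_pow_div {x : ℂ} (hx : ‖x‖ < 1) (j : ℕ) :
    Summable fun p : ℕ × ℕ =>
      ((p.1 + 1).choose j : ℂ) * x ^ (p.1 + 1) * (1 / ((p.2 : ℂ) + 1) ^ (p.1 + 2)) := by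
  have h1 : Summable fun k : ℕ => ‖((k + 1).choose j : ℂ) * x ^ (k + 1)‖ :=
    ((summable_nat_add_iff 1).2 (hasSum_choose_mul_pow hx j).summable).norm
  have h2 : Summable fun m : ℕ => ‖1 / ((m : ℂ) + 1) ^ 2‖ :=
    (hasSum_riemannZeta_nat_add_two 0).summable.norm
  refine Summable.of_norm_bounded
    (h1.mul_of_nonneg h2 (fun _ => norm_nonneg _) fun _ => norm_nonneg _) fun p => ?_
  have hp : (1 : ℝ) ≤ ‖(p.2 : ℂ) + 1‖ := by
    rw [← Nat.cast_add_one, Complex.norm_natCast]; simp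
  rw [norm_mul]
  gcongr
  simp only [norm_div, norm_pow, norm_one]
  exact one_div_le_one_div_of_le (by positivity) (pow_le_pow_right₀ hp (by lia))

/-- Interchange of the sums over `k` and over the terms of the zeta series. -/
theorem hasSum_riemannZeta_mul_choose {x : ℂ} (hx : ‖x‖ < 1) (j : ℕ) {g : ℕ → ℂ}
    (hg : ∀ m : ℕ, HasSum (fun k : ℕ =>
      ((k + 1).choose j : ℂ) * x ^ (k + 1) * (1 / ((m : ℂ) + 1) ^ (k + 2))) (g m)) :
    Summable g ∧ HasSum (fun k : ℕ =>
      riemannZeta (((k + 1 : ℕ) : ℂ) + 1) * ((k + 1).choose j : ℂ) * x ^ (k + 1)) (∑' m, g m) := by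
  have h := (summable_choose_mul_pow_div hx j).hasSum
  have h1 := h.prod_fiberwise fun k =>
    (hasSum_riemannZeta_nat_add_two k).mul_left (((k + 1).choose j : ℂ) * x ^ (k + 1))
  have h2 := ((Equiv.prodComm ℕ ℕ).hasSum_iff.2 h).prod_fiberwise hg
  refine ⟨h2.summable, ?_⟩
  rw [h2.tsum_eq]
  convert! h1 using 2
  ring

theorem norm_div_nat_add_one_lt {x : ℂ} (hx : ‖x‖ < 1) (m : ℕ) : ‖x / ((m : ℂ) + 1)‖ < 1 := by
  rw [← Nat.cast_add_one, norm_div, Complex.norm_natCast, div_lt_one (by positivity)]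
  push_cast
  linarith [(m.cast_nonneg : (0 : ℝ) ≤ m)]

theorem one_sub_div_nat_add_one_ne_zero {x : ℂ} (hx : ‖x‖ < 1) (m : ℕ) :
    1 - x / ((m : ℂ) + 1) ≠ 0 := fun h => by
  have := norm_div_nat_add_one_lt hx m
  rw [← sub_eq_zero.1 h, norm_one] at this
  exact this.false

theorem nat_add_one_sub_ne_zero {x : ℂ} (hx : ‖x‖ < 1) (m : ℕ) : (m : ℂ) + 1 - x ≠ 0 := by
  have hm : (m : ℂ) + 1 ≠ 0 := m.cast_add_one_ne_zero
  have := mul_ne_zero hm (one_sub_div_nat_add_one_ne_zero hx m)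
  rwa [mul_sub, mul_one, mul_div_cancel₀ _ hm] at this

theorem hasSum_riemannZeta_mul_choose_hurwitz {x : ℂ} (hx : ‖x‖ < 1) {j : ℕ} (hj : j ≠ 0) :
    HasSum (fun k : ℕ => riemannZeta (((k + 1 : ℕ) : ℂ) + 1) * ((k + 1).choose j : ℂ) * x ^ (k + 1))
      (hurwitzZetaSeries ((j : ℂ) + 1) (1 - x) * x ^ j) := by
  rw [hurwitzZetaSeries, ← tsum_mul_right]
  refine (hasSum_riemannZeta_mul_choose hx j fun m => ?_).2
  have hm : (m : ℂ) + 1 ≠ 0 := m.cast_add_one_ne_zero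
  have hm' := nat_add_one_sub_ne_zero hx m
  have h := (hasSum_choose_mul_pow (norm_div_nat_add_one_lt hx m) j)
  -- The dropped term `k = 0` is zero because `j ≠ 0`.
  rw [← hasSum_nat_add_iff' 1] at h
  simp only [Finset.range_one, Finset.sum_singleton, Nat.choose_eq_zero_of_lt (Nat.pos_of_ne_zero hj),
    Nat.cast_zero, zero_mul, sub_zero] at h
  convert! h.mul_left (1 / ((m : ℂ) + 1)) using 1
  · ext k
    rw [div_pow]; field_simp; ring
  · have e : 1 - x / ((m : ℂ) + 1) = (m + 1 - x) / (m + 1) := by field_simp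
    rw [← Nat.cast_add_one j, Complex.cpow_natCast, e, div_pow, div_pow, ← add_sub_assoc]
    field_simp
    ring

theorem hasSum_riemannZeta_mul_pow {x : ℂ} (hx : ‖x‖ < 1) :
    Summable (fun m : ℕ => 1 / ((m : ℂ) + 1 - x) - 1 / ((m : ℂ) + 1)) ∧
    HasSum (fun k : ℕ => riemannZeta (((k + 1 : ℕ) : ℂ) + 1) * x ^ (k + 1))
      (∑' m : ℕ, (1 / ((m : ℂ) + 1 - x) - 1 / ((m : ℂ) + 1))) := by
  have key := hasSum_riemannZeta_mul_choose hx 0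
    (g := fun m : ℕ => 1 / ((m : ℂ) + 1 - x) - 1 / ((m : ℂ) + 1)) fun m => ?_
  · simpa using key
  have hm : (m : ℂ) + 1 ≠ 0 := m.cast_add_one_ne_zero
  have hm' := nat_add_one_sub_ne_zero hx m
  have h := (hasSum_choose_mul_pow (norm_div_nat_add_one_lt hx m) 0)
  -- Here the dropped term is `1`; it produces the `- 1 / (m + 1)` that makes the sum over `m`
  -- converge.
  rw [← hasSum_nat_add_iff' 1] at h
  convert! h.mul_left (1 / ((m : ℂ) + 1)) using 1
  · ext k
    rw [div_pow]; field_simp; ring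
  · have e : 1 - x / ((m : ℂ) + 1) = (m + 1 - x) / (m + 1) := by field_simp
    simp [e]
    field_simp

/-! ### Weierstrass product and digamma series -/

/-- The general term of the Weierstrass product of `x ↦ exp (γ x) / Γ(1 - x)`, minus `1`. -/
noncomputable def gammaProdTerm (m : ℕ) (x : ℂ) : ℂ :=
  (1 - x / ((m : ℂ) + 1)) * Complex.exp (x / ((m : ℂ) + 1)) - 1

theorem norm_gammaProdTerm_le {x : ℂ} (hx : ‖x‖ < 1) (m : ℕ) :
    ‖gammaProdTerm m x‖ ≤ 3 * ‖1 / ((m : ℂ) + 1) ^ 2‖ := by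
  set y := x / ((m : ℂ) + 1) with hy
  have hy1 : ‖y‖ < 1 := norm_div_nat_add_one_lt hx m
  have hyle : ‖y‖ ^ 2 ≤ ‖1 / ((m : ℂ) + 1) ^ 2‖ := by
    rw [hy, norm_div, div_pow, norm_div, norm_one, norm_pow]
    gcongr
    exact pow_le_one₀ (norm_nonneg _) hx.le
  -- The linear terms cancel, so each remaining piece is quadratic in `y`.
  have he : gammaProdTerm m x = (1 - y) * (Complex.exp y - 1 - y) - y ^ 2 := by
    rw [gammaProdTerm, ← hy]; ring
  calc ‖gammaProdTerm m x‖ ≤ ‖1 - y‖ * ‖Complex.exp y - 1 - y‖ + ‖y‖ ^ 2 := by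
        rw [he, ← norm_mul, ← norm_pow]; exact norm_sub_le _ _
    _ ≤ 2 * ‖y‖ ^ 2 + ‖y‖ ^ 2 := by
        gcongr
        · calc ‖1 - y‖ ≤ ‖(1 : ℂ)‖ + ‖y‖ := norm_sub_le _ _
            _ ≤ 2 := by rw [norm_one]; linarith
        · exact Complex.norm_exp_sub_one_sub_id_le hy1.le
    _ ≤ _ := by linarith

theorem hasProdLocallyUniformlyOn_gammaProdTerm :
    HasProdLocallyUniformlyOn (fun m x => 1 + gammaProdTerm m x)
      (fun x => ∏' m, (1 + gammaProdTerm m x)) (Metric.ball 0 1) := by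
  refine Summable.hasProdLocallyUniformlyOn_nat_one_add Metric.isOpen_ball
    ((hasSum_riemannZeta_nat_add_two 0).summable.norm.mul_left 3)
    (.of_forall fun m x hx => norm_gammaProdTerm_le (by simpa using hx) m) fun m => ?_
  unfold gammaProdTerm
  fun_prop

/-- The exponentials multiply to `exp (x H_(n+1))`, with `H_(n+1) = H_n + 1 / (n + 1)`. The factor
`n ^ (-x)` in `GammaSeq` supplies `-log n`, so that the exponent converges, and `n / (n + 1)` is `n
* n! / (n + 1)!`. -/
theorem prod_one_add_gammaProdTerm {x : ℂ} (hx : ‖x‖ < 1) {n : ℕ} (hn : n ≠ 0) :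
    ∏ m ∈ Finset.range (n + 1), (1 + gammaProdTerm m x) =
      (n / (n + 1) : ℂ) *
        Complex.exp (x * ((harmonic n - Real.log n : ℝ) + 1 / (n + 1))) /
        Complex.GammaSeq (1 - x) n := by
  have hn' : (n : ℂ) ≠ 0 := by exact_mod_cast hn
  have hn1 : (n : ℂ) + 1 ≠ 0 := n.cast_add_one_ne_zero
  have hf : (n.factorial : ℂ) ≠ 0 := by exact_mod_cast n.factorial_ne_zero
  have hprod : ∏ m ∈ Finset.range (n + 1), (1 - x + (m : ℂ)) =
      ((n + 1).factorial : ℂ) * ∏ m ∈ Finset.range (n + 1), (1 - x / ((m : ℂ) + 1)) := by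
    rw [← Finset.prod_range_add_one_eq_factorial, Nat.cast_prod, ← Finset.prod_mul_distrib]
    refine Finset.prod_congr rfl fun m _ => ?_
    have hm : (m : ℂ) + 1 ≠ 0 := m.cast_add_one_ne_zero
    push_cast
    field_simp
    ring
  have hne : ∏ m ∈ Finset.range (n + 1), (1 - x / ((m : ℂ) + 1)) ≠ 0 :=
    Finset.prod_ne_zero_iff.2 fun m _ => one_sub_div_nat_add_one_ne_zero hx m
  have hexp : ∏ m ∈ Finset.range (n + 1), Complex.exp (x / ((m : ℂ) + 1)) =
      Complex.exp (x * ((harmonic n : ℝ) + 1 / (n + 1))) := by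
    rw [← Complex.exp_sum, Finset.sum_range_succ, harmonic]
    congr 1
    push_cast
    rw [mul_add, Finset.mul_sum]
    simp [div_eq_mul_inv]
  have hcpow : (n : ℂ) ^ (1 - x) = n * Complex.exp (-(x * (Real.log n : ℝ))) := by
    rw [Complex.cpow_sub _ _ hn', Complex.cpow_one, Complex.cpow_def_of_ne_zero hn',
      Complex.natCast_log, Complex.exp_neg, div_eq_mul_inv, mul_comm x]
  have hsplit : Complex.exp (x * ((harmonic n - Real.log n : ℝ) + 1 / (n + 1))) =
      Complex.exp (x * ((harmonic n : ℝ) + 1 / (n + 1))) *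
        Complex.exp (-(x * (Real.log n : ℝ))) := by
    rw [← Complex.exp_add]
    congr 1
    push_cast
    ring
  have he := Complex.exp_ne_zero (-(x * (Real.log n : ℝ)))
  simp only [gammaProdTerm, add_sub_cancel]
  rw [Finset.prod_mul_distrib, hexp, Complex.GammaSeq, hprod, hcpow, hsplit, Nat.factorial_succ]
  push_cast
  field_simp

theorem tprod_one_add_gammaProdTerm {x : ℂ} (hx : ‖x‖ < 1) :
    ∏' m, (1 + gammaProdTerm m x) =
      Complex.exp (x * Real.eulerMascheroniConstant) / Complex.Gamma (1 - x) := by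
  have h1 := (hasProdLocallyUniformlyOn_gammaProdTerm.hasProd
    (show x ∈ Metric.ball 0 1 by simpa using hx)).tendsto_prod_nat
  have hG : Complex.Gamma (1 - x) ≠ 0 := Complex.Gamma_ne_zero fun m h =>
    nat_add_one_sub_ne_zero hx m (by linear_combination h)
  have hinv : Tendsto (fun n : ℕ => (1 / ((n : ℂ) + 1))) atTop (𝓝 0) :=
    tendsto_one_div_add_atTop_nhds_zero_nat
  have hfrac : Tendsto (fun n : ℕ => ((n : ℂ) / (n + 1))) atTop (𝓝 1) :=
    tendsto_natCast_div_add_atTop 1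
  have hexp : Tendsto (fun n : ℕ => Complex.exp
      (x * ((harmonic n - Real.log n : ℝ) + 1 / (n + 1)))) atTop
      (𝓝 (Complex.exp (x * (Real.eulerMascheroniConstant + 0)))) :=
    (((Complex.continuous_ofReal.tendsto _).comp Real.tendsto_harmonic_sub_log).add
      hinv |>.const_mul x).cexp
  have h2 := (hfrac.mul hexp).div (Complex.GammaSeq_tendsto_Gamma (1 - x)) hG
  rw [one_mul, add_zero] at h2
  refine tendsto_nhds_unique ((tendsto_add_atTop_iff_nat 1).2 h1) (h2.congr' ?_)
  filter_upwards [eventually_ne_atTop 0] with n hn using (prod_one_add_gammaProdTerm hx hn).symm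

theorem logDeriv_one_add_gammaProdTerm {x : ℂ} (hx : ‖x‖ < 1) (m : ℕ) :
    logDeriv (fun z => 1 + gammaProdTerm m z) x =
      -(1 / ((m : ℂ) + 1 - x) - 1 / ((m : ℂ) + 1)) := by
  have hm : (m : ℂ) + 1 ≠ 0 := m.cast_add_one_ne_zero
  have hm' := nat_add_one_sub_ne_zero hx m
  have e : 1 - x / ((m : ℂ) + 1) = (m + 1 - x) / (m + 1) := by field_simp
  have hd : HasDerivAt (fun z : ℂ => z / ((m : ℂ) + 1)) (1 / ((m : ℂ) + 1)) x :=
    (hasDerivAt_id x).div_const _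
  have h := (hd.const_sub 1).mul hd.cexp
  have hfun : (fun z => 1 + gammaProdTerm m z) =
      (fun z => 1 - z / ((m : ℂ) + 1)) * fun z => Complex.exp (z / ((m : ℂ) + 1)) := by
    ext z; simp [gammaProdTerm]
  have he := Complex.exp_ne_zero (x / ((m : ℂ) + 1))
  rw [hfun, logDeriv_apply, h.deriv, Pi.mul_apply, e]
  field_simp
  ring

/-- The series `∑ (1 / (m + 1 - x) - 1 / (m + 1))` of the digamma function in the unit disc. -/
theorem tsum_digamma {x : ℂ} (hx : ‖x‖ < 1) :
    ∑' m : ℕ, (1 / ((m : ℂ) + 1 - x) - 1 / ((m : ℂ) + 1)) =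
      -(Complex.digamma (1 - x) + (Real.eulerMascheroniConstant : ℂ)) := by
  have hmem : x ∈ Metric.ball (0 : ℂ) 1 := by simpa using hx
  have hG : Complex.Gamma (1 - x) ≠ 0 := Complex.Gamma_ne_zero fun m h =>
    nat_add_one_sub_ne_zero hx m (by linear_combination h)
  have hGd : DifferentiableAt ℂ Complex.Gamma (1 - x) :=
    Complex.differentiableAt_Gamma _ fun m h =>
      nat_add_one_sub_ne_zero hx m (by linear_combination h)
  have hsum := (hasSum_riemannZeta_mul_pow hx).1
  have hprod := tprod_one_add_gammaProdTerm hx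
  have hlog := logDeriv_tprod_eq_tsum Metric.isOpen_ball hmem
    (f := fun m x => 1 + gammaProdTerm m x)
    (fun m => by
      simpa [gammaProdTerm] using one_sub_div_nat_add_one_ne_zero hx m)
    (fun m => by unfold gammaProdTerm; fun_prop)
    (by simpa only [logDeriv_one_add_gammaProdTerm hx] using hsum.neg)
    hasProdLocallyUniformlyOn_gammaProdTerm.multipliableLocallyUniformlyOn
    (by rw [hprod]; exact div_ne_zero (Complex.exp_ne_zero _) hG)
  simp only [logDeriv_one_add_gammaProdTerm hx, tsum_neg] at hlog
  rw [← neg_eq_iff_eq_neg, ← hlog]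
  -- Differentiating the product requires its closed form on a neighbourhood of `x`.
  have heq : (fun z => ∏' m, (1 + gammaProdTerm m z)) =ᶠ[𝓝 x] fun z =>
      Complex.exp (z * Real.eulerMascheroniConstant) / Complex.Gamma (1 - z) := by
    filter_upwards [Metric.isOpen_ball.mem_nhds hmem] with z hz
    exact tprod_one_add_gammaProdTerm (by simpa using hz)
  have h1 : HasDerivAt (fun z : ℂ => Complex.exp (z * Real.eulerMascheroniConstant))
      (Complex.exp (x * Real.eulerMascheroniConstant) * (1 * Real.eulerMascheroniConstant)) x :=
    ((hasDerivAt_id x).mul_const _).cexp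
  have h2 : HasDerivAt (fun z : ℂ => Complex.Gamma (1 - z))
      (deriv Complex.Gamma (1 - x) * -1) x :=
    hGd.hasDerivAt.comp x ((hasDerivAt_id x).const_sub 1)
  have he := Complex.exp_ne_zero (x * Real.eulerMascheroniConstant)
  rw [logDeriv_apply, heq.deriv_eq, heq.eq_of_nhds, (h1.fun_div h2 hG).deriv, Complex.digamma_def,
    logDeriv_apply]
  field_simp
  ring

theorem mainTheorem2 (α β r x : ℂ) (n : ℕ) (hx : ‖x‖ < 1) :
    HasSum
      (fun k : ℕ =>
        riemannZeta (((k + 1 : ℕ) : ℂ) + 1) *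
          genFactorial (r + ((k + 1 : ℕ) : ℂ) * β) α n * x ^ (k + 1))
      (-genFactorial r α n *
          (Complex.digamma (1 - x) + (Real.eulerMascheroniConstant : ℂ)) +
        ∑ k ∈ Finset.Icc 1 n,
          genStirling n k α β r * (k.factorial : ℂ) *
            hurwitzZetaSeries ((k : ℂ) + 1) (1 - x) * (β * x) ^ k) := by
  have h0 := (hasSum_riemannZeta_mul_pow hx).2.mul_left (genFactorial r α n)
  rw [tsum_digamma hx] at h0
  have h1 := hasSum_sum fun j (hj : j ∈ Finset.Icc 1 n) =>
    (hasSum_riemannZeta_mul_choose_hurwitz hx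
      (Nat.one_le_iff_ne_zero.1 (Finset.mem_Icc.1 hj).1)).mul_left
        (genStirling n j α β r * (j.factorial : ℂ) * β ^ j)
  convert! h0.add h1 using 1
  · ext k
    -- The index `j = 0` is split off: it carries the digamma term, with coefficient `genFactorial r
    -- α n`.
    have hr : Finset.range (n + 1) = insert 0 (Finset.Icc 1 n) := by
      ext j; simp only [Finset.mem_range, Finset.mem_insert, Finset.mem_Icc]; lia
    rw [genFactorial_add_nat_mul, hr, Finset.sum_insert (by simp), genStirling_zero_right,
      mul_add, add_mul, Finset.mul_sum, Finset.sum_mul]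
    congr 1
    · simp; ring
    · exact Finset.sum_congr rfl fun j _ => by ring
  · congr 1
    · ring
    · exact Finset.sum_congr rfl fun j _ => by rw [mul_pow]; ring
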